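/- Let $\mathcal A$ be a locally noetherian Grothendieck cosmos, that is, a symmetric monoidal closed category, with tensor product $\otimes$, unit $I$ and internal Hom $[-,-]$, whose underlying category is a Grothendieck category with a small generating set of noetherian objects. Let $G$ be a group acting on $\mathcal A$, that is, let a group homomorphism from $G$ to the group of isomorphism classes of autoequivalences of $\mathcal A$ be given; write $g\cdot X$ for the action of $g\in G$ on $X\in\mathcal A$. All subcategories are full and closed under isomorphisms. Let $\mathcal A_{\mathrm{noeth}}$ be the subcategory of noetherian objects. *Definitions.* A nonzero object $H$ is *monoform* if for every nonzero subobject $L\subseteq H$ there is no common nonzero subobject of $H$ and $H/L$. Two monoform objects are *atom-equivalent* if they have a common nonzero subobject. The *atom spectrum* $\operatorname{Spec}\mathcal A$ is the set of equivalence classes $\overline H$ of monoform objects. For $M\in\mathcal A$ put $\operatorname{Supp}M=\{\overline H: H \text{ is a monoform subquotient of } M\}$ and $\operatorname{Ass}M=\{\overline H: H\text{ is a monoform subobject of }M\}$; the sets $\operatorname{Supp}M$ form an open basis of the topology of $\operatorname{Spec}\mathcal A$. The group $G$ acts on $\operatorname{Spec}\mathcal A$ by $g\cdot\overline H=\overline{g\cdot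 H}$. The *orbit atom spectrum* is the quotient space $\pi_G\colon\operatorname{Spec}\mathcal A\to\operatorname{Spec}^G\mathcal A=(\operatorname{Spec}\mathcal A)/G$, and $\operatorname{Supp}^GM=\pi_G(\operatorname{Supp}M)$, $\operatorname{Ass}^GM=\pi_G(\operatorname{Ass}M)$. A subcategory $\mathcal X$ is *$G$-closed* if $g\cdot X\in\mathcal X$ for all $g\in G$, $X\in\mathcal X$. A *localizing subcategory* of $\mathcal A$ is a Serre subcategory closed under coproducts. A *torsion-free class* of $\mathcal A_{\mathrm{noeth}}$ is a subcategory of $\mathcal A_{\mathrm{noeth}}$ that contains $0$ and is closed under subobjects and extensions. An object $D$ is *dualizable* if there are an object $E$ and morphisms $I\to D\otimes E$ and $E\otimes D\to I$ satisfying the triangle identities. Assume: 1. (C1) the unit object $I$ is finitely presented; 2. (C2) $\mathcal A$ is generated by a small set of dualizable objects; 3. $\mathrm{Loc}_\otimes\mathcal A=\mathrm{Loc}_G\mathcal A$: the set of localizing subcategories $\mathcal X$ of $\mathcal A$ that are tensor ideals ($X\otimes M\in\mathcal X$ for all $X\in\mathcal X$, $M\in\mathcal A$) equals the set of $G$-closed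 localizing subcategories; 4. $\mathrm{torf}_{\mathrm{Hom}}\mathcal A_{\mathrm{noeth}}=\mathrm{torf}_G\mathcal A_{\mathrm{noeth}}$: the set of torsion-free classes $\mathcal X$ of $\mathcal A_{\mathrm{noeth}}$ that are Hom ideals ($[M,X]\in\mathcal X$ for all $X\in\mathcal X$, $M\in\mathcal A_{\mathrm{noeth}}$) equals the set of $G$-closed torsion-free classes of $\mathcal A_{\mathrm{noeth}}$; 5. ($*$) for every $M\in\mathcal A$ and every $x\in\operatorname{Supp}^GM$ there is $y\in\operatorname{Ass}^GM$ with $y\in\overline{\{x\}}$, the closure being taken in $\operatorname{Spec}^G\mathcal A$. **Theorem.** The assignments $$\Phi\mapsto(\operatorname{Ass}^G)^{-1}(\Phi)=\{M\in\mathcal A_{\mathrm{noeth}}:\operatorname{Ass}^GM\subseteq\Phi\},\qquad \mathcal X\mapsto\operatorname{Ass}^G\mathcal X=\bigcup_{X\in\mathcal X}\operatorname{Ass}^GX$$ are mutually inverse, inclusion-preserving bijections between the set of all subsets $\Phi$ of $\operatorname{Spec}^G\mathcal A$ and the set of $G$-closed torsion-free classes $\mathcal X$ of $\mathcal A_{\mathrm{noeth}}$.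 -/

import Mathlib

open CategoryTheory CategoryTheory.Limits CategoryTheory.MonoidalCategory

universe v u w

namespace OrbitAtom

/-! ### The atom spectrum of an abelian category -/

section Atoms

variable {C : Type u} [Category.{v} C]

/-- `X` and `Y` have a common nonzero subobject (up to isomorphism). -/
def HasCommonSubobject (X Y : C) : Prop :=
  ∃ (Z : C) (i : Z ⟶ X) (j : Z ⟶ Y), Mono i ∧ Mono j ∧ ¬ IsZero Z

theorem HasCommonSubobject.symm {X Y : C} (h : HasCommonSubobject X Y) :
    HasCommonSubobject Y X := by
  obtain ⟨Z, i, j, hi, hj, hZ⟩ := h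
  exact ⟨Z, j, i, hj, hi, hZ⟩

theorem HasCommonSubobject.of_mono {X Y X' Y' : C} (h : HasCommonSubobject X Y)
    (f : X ⟶ X') (g : Y ⟶ Y') [Mono f] [Mono g] : HasCommonSubobject X' Y' := by
  obtain ⟨Z, i, j, hi, hj, hZ⟩ := h
  exact ⟨Z, i ≫ f, j ≫ g, mono_comp _ _, mono_comp _ _, hZ⟩

variable [Abelian C]

/-- A nonzero object `H` is monoform if for every nonzero subobject `L` of `H`, the objects `H` and
`H / L` have no common nonzero subobject. -/
structure IsMonoform (H : C) : Prop where
  not_isZero : ¬ IsZero H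
  not_common : ∀ (L : C) (i : L ⟶ H), Mono i → ¬ IsZero L → ¬ HasCommonSubobject H (cokernel i)

/-- Two nonzero subobjects of a monoform object intersect nontrivially. -/
theorem IsMonoform.pullback_not_isZero {H : C} (hH : IsMonoform H) {K L : C} (i : K ⟶ H)
    (j : L ⟶ H) [Mono i] [Mono j] (hK : ¬ IsZero K) (hL : ¬ IsZero L) :
    ¬ IsZero (pullback i j) := by
  intro h0
  refine hH.not_common L j inferInstance hL ⟨K, i, i ≫ cokernel.π j, inferInstance, ?_, hK⟩
  refine Preadditive.mono_of_cancel_zero _ fun {Z} g hg => ?_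
  rw [← Category.assoc] at hg
  have hk : Abelian.monoLift j (g ≫ i) hg ≫ j = g ≫ i := Abelian.monoLift_comp _ _ _
  have : g = pullback.lift g (Abelian.monoLift j (g ≫ i) hg) hk.symm ≫ pullback.fst i j :=
    (pullback.lift_fst _ _ _).symm
  rw [this, h0.eq_of_tgt (pullback.lift _ _ _) 0, zero_comp]

theorem HasCommonSubobject.trans {X Y Z : C} (hY : IsMonoform Y) (h₁ : HasCommonSubobject X Y)
    (h₂ : HasCommonSubobject Y Z) : HasCommonSubobject X Z := by
  obtain ⟨K, i, j, hi, hj, hK⟩ := h₁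
  obtain ⟨L, k, l, hk, hl, hL⟩ := h₂
  exact ⟨pullback j k, pullback.fst j k ≫ i, pullback.snd j k ≫ l, mono_comp _ _, mono_comp _ _,
    hY.pullback_not_isZero j k hK hL⟩

variable (C) in
/-- Atom equivalence of monoform objects. -/
instance atomSetoid : Setoid {H : C // IsMonoform H} where
  r H₁ H₂ := HasCommonSubobject H₁.1 H₂.1
  iseqv :=
    { refl := fun H => ⟨H.1, 𝟙 _, 𝟙 _, inferInstance, inferInstance, H.2.not_isZero⟩
      symm := fun h => h.symm
      trans := fun {_ H₂ _} h₁ h₂ => h₁.trans H₂.2 h₂ }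

variable (C) in
/-- The atom spectrum: atom-equivalence classes of monoform objects. -/
def AtomSpectrum : Type u := Quotient (atomSetoid C)

/-- The atom of a monoform object. -/
def IsMonoform.atom {H : C} (hH : IsMonoform H) : AtomSpectrum C :=
  Quotient.mk (atomSetoid C) ⟨H, hH⟩

/-- The atom support: atoms of the monoform subquotients of `M`. -/
def atomSupp (M : C) : Set (AtomSpectrum C) :=
  {α | ∃ (H : C) (hH : IsMonoform H), hH.atom = α ∧
    ∃ (K : C) (i : K ⟶ M) (p : K ⟶ H), Mono i ∧ Epi p}

/-- The associated atoms: atoms of the monoform subobjects of `M`. -/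
def atomAss (M : C) : Set (AtomSpectrum C) :=
  {α | ∃ (H : C) (hH : IsMonoform H), hH.atom = α ∧ ∃ i : H ⟶ M, Mono i}

/-- The topology with open basis the atom supports of objects. -/
instance : TopologicalSpace (AtomSpectrum C) :=
  TopologicalSpace.generateFrom (Set.range (atomSupp (C := C)))

/-! ### Autoequivalences act on atoms -/

theorem not_isZero_map (e : C ≌ C) {X : C} (hX : ¬ IsZero X) : ¬ IsZero (e.functor.obj X) :=
  fun h => hX ((e.inverse.map_isZero h).of_iso (e.unitIso.app X))

theorem HasCommonSubobject.map (e : C ≌ C) {X Y : C} (h : HasCommonSubobject X Y) :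
    HasCommonSubobject (e.functor.obj X) (e.functor.obj Y) := by
  obtain ⟨Z, i, j, hi, hj, hZ⟩ := h
  exact ⟨e.functor.obj Z, e.functor.map i, e.functor.map j, inferInstance, inferInstance,
    not_isZero_map e hZ⟩

theorem IsMonoform.of_iso {H H' : C} (hH : IsMonoform H) (f : H ≅ H') : IsMonoform H' where
  not_isZero h := hH.not_isZero (h.of_iso f)
  not_common L i _ hL h :=
    hH.not_common L (i ≫ f.inv) (mono_comp _ _) hL
      (h.of_mono f.inv (cokernelCompIsIso i f.inv).inv)

theorem IsMonoform.map (e : C ≌ C) {H : C} (hH : IsMonoform H) :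
    IsMonoform (e.functor.obj H) where
  not_isZero := not_isZero_map e hH.not_isZero
  not_common L i _ hL h := by
    have hH' : IsMonoform (e.inverse.obj (e.functor.obj H)) := hH.of_iso (e.unitIso.app H)
    refine hH'.not_common (e.inverse.obj L) (e.inverse.map i) inferInstance
      (not_isZero_map e.symm hL) ?_
    exact (h.map e.symm).of_mono (𝟙 _) (PreservesCokernel.iso e.inverse i).hom

/-- The action of an autoequivalence on the atom spectrum, `[H] ↦ [e H]`. -/
def atomMap (e : C ≌ C) : AtomSpectrum C → AtomSpectrum C :=
  Quotient.map (fun H => ⟨e.functor.obj H.1, H.2.map e⟩) fun _ _ h => HasCommonSubobject.map e h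

end Atoms

/-! ### Group actions and the orbit atom spectrum -/

/-- An action of a group `G` on a category `C`: a group homomorphism from `G` to the group of
isomorphism classes of autoequivalences of `C`, presented by a choice of representatives. -/
structure GroupAction (G : Type w) [Group G] (C : Type u) [Category.{v} C] where
  /-- the autoequivalence `X ↦ g · X` -/
  equiv : G → (C ≌ C)
  one_iso : Nonempty ((equiv 1).functor ≅ 𝟭 C)
  mul_iso : ∀ g h : G, Nonempty ((equiv (g * h)).functor ≅ (equiv h).functor ⋙ (equiv g).functor)

namespace GroupAction

variable {G : Type w} [Group G] {C : Type u} [Category.{v} C] (ρ : GroupAction G C)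

/-- `g · X`. -/
abbrev obj (g : G) (X : C) : C := (ρ.equiv g).functor.obj X

/-- A subcategory closed under the action. -/
def IsGClosed (P : ObjectProperty C) : Prop := ∀ (g : G) (X : C), P X → P (ρ.obj g X)

variable [Abelian C]

/-- `g · α` for an atom `α`. -/
def smulAtom (g : G) : AtomSpectrum C → AtomSpectrum C := atomMap (ρ.equiv g)

theorem one_smulAtom (α : AtomSpectrum C) : ρ.smulAtom 1 α = α := by
  obtain ⟨e⟩ := ρ.one_iso
  induction α using Quotient.inductionOn with
  | h H =>
    exact Quotient.sound (s := atomSetoid C) ⟨_, 𝟙 _, (e.app H.1).hom, inferInstance, inferInstance,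
      not_isZero_map _ H.2.not_isZero⟩

theorem mul_smulAtom (g h : G) (α : AtomSpectrum C) :
    ρ.smulAtom (g * h) α = ρ.smulAtom g (ρ.smulAtom h α) := by
  obtain ⟨e⟩ := ρ.mul_iso g h
  induction α using Quotient.inductionOn with
  | h H =>
    exact Quotient.sound (s := atomSetoid C) ⟨_, 𝟙 _, (e.app H.1).hom, inferInstance, inferInstance,
      not_isZero_map _ H.2.not_isZero⟩

/-- Two atoms are equivalent if they lie in the same `G`-orbit. -/
def orbitSetoid : Setoid (AtomSpectrum C) where
  r α β := ∃ g : G, ρ.smulAtom g α = β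
  iseqv :=
    { refl := fun α => ⟨1, ρ.one_smulAtom α⟩
      symm := by
        rintro α _ ⟨g, rfl⟩
        exact ⟨g⁻¹, by rw [← mul_smulAtom, inv_mul_cancel, one_smulAtom]⟩
      trans := by
        rintro α _ _ ⟨g, rfl⟩ ⟨h, rfl⟩
        exact ⟨h * g, ρ.mul_smulAtom h g α⟩ }

/-- The orbit atom spectrum: the quotient of the atom spectrum by `G`. -/
def OrbitSpectrum : Type u := Quotient ρ.orbitSetoid

/-- The quotient topology. -/
instance : TopologicalSpace ρ.OrbitSpectrum :=
  inferInstanceAs (TopologicalSpace (Quotient ρ.orbitSetoid))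

/-- The quotient map. -/
def proj : AtomSpectrum C → ρ.OrbitSpectrum := Quotient.mk ρ.orbitSetoid

/-- The image of the atom support in the orbit atom spectrum. -/
def supp (M : C) : Set ρ.OrbitSpectrum := ρ.proj '' atomSupp M

/-- The image of the set of associated atoms in the orbit atom spectrum. -/
def ass (M : C) : Set ρ.OrbitSpectrum := ρ.proj '' atomAss M

/-- The union of the sets `ass X` over the objects `X` of a subcategory. -/
def assOf (P : ObjectProperty C) : Set ρ.OrbitSpectrum := ⋃ (X : C) (_ : P X), ρ.ass X

/-- The noetherian objects all of whose associated orbits lie in `Φ`. -/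
def assInv (Φ : Set ρ.OrbitSpectrum) : ObjectProperty C :=
  fun M => isNoetherianObject M ∧ ρ.ass M ⊆ Φ

end GroupAction

/-! ### Classes of subcategories -/

section Subcategories

variable {C : Type u} [Category.{v} C] [Abelian C]

/-- A localizing subcategory: a Serre subcategory closed under small coproducts. -/
structure IsLocalizing (P : ObjectProperty C) : Prop where
  isSerreClass : P.IsSerreClass
  coproducts : ∀ J : Type v, P.IsClosedUnderColimitsOfShape (Discrete J)

/-- A torsion-free class of the abelian category of noetherian objects of `C`. Subobjects,
quotients and extensions of noetherian objects of `C` are noetherian, so exactness may be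
tested in `C`. -/
structure IsNoethTorsionFree (P : ObjectProperty C) : Prop where
  le_noetherian : P ≤ isNoetherianObject
  zero : P.ContainsZero
  subobjects : P.IsClosedUnderSubobjects
  extensions : P.IsClosedUnderExtensions

/-- `C` has a small generating set of objects satisfying `P`. -/
def GeneratedBy (P : ObjectProperty C) : Prop :=
  ∃ S : ObjectProperty C, ObjectProperty.Small.{v} S ∧ S ≤ P ∧ S.IsSeparating

variable (C) in
/-- A small set of noetherian generators exists. -/
def IsLocallyNoetherian : Prop := GeneratedBy (isNoetherianObject (C := C))

/-- The set of `G`-closed localizing subcategories of `C`. -/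
def locG {G : Type w} [Group G] (ρ : GroupAction G C) : Set (ObjectProperty C) :=
  {P | IsLocalizing P ∧ ρ.IsGClosed P}

/-- The set of `G`-closed torsion-free classes of the category of noetherian objects. -/
def torfG {G : Type w} [Group G] (ρ : GroupAction G C) : Set (ObjectProperty C) :=
  {P | IsNoethTorsionFree P ∧ ρ.IsGClosed P}

variable [MonoidalCategory C]

/-- An object is dualizable if it has a dual: an object `E` with morphisms `I ⟶ D ⊗ E` and
`E ⊗ D ⟶ I` satisfying the triangle identities. -/
def IsDualizable (D : C) : Prop := ∃ E : C, Nonempty (ExactPairing D E)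

variable (C) in
/-- The set of localizing tensor ideals. -/
def locTensor : Set (ObjectProperty C) :=
  {P | IsLocalizing P ∧ ∀ X M : C, P X → P (X ⊗ M)}

variable (C) in
/-- The set of torsion-free classes of the category of noetherian objects that are closed under
internal Hom out of noetherian objects. -/
def torfHom [MonoidalClosed C] : Set (ObjectProperty C) :=
  {P | IsNoethTorsionFree P ∧
    ∀ X M : C, P X → isNoetherianObject M → P ((ihom M).obj X)}

end Subcategories

end OrbitAtom

namespace OrbitAtom

/-! ### Subobjects and noetherian objects in abelian categories -/

section Noetherian

variable {C : Type u} [Category.{v} C] [Abelian C]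

/-! One composite is easy: each orbit has a noetherian monoform representative, whose only
associated atom is its own (`assOf_assInv`). The content is `prop_of_ass_subset_assOf`: a noetherian
`M` with associated orbits in those of the class `P` belongs to `P`.

The tool is the annihilator of an object `N`, the kernel of `I ⟶ [N, N]`. For noetherian monoform
`N` with orbit `x`, the embedding of `I / ann N` into `[N, N]` and the Hom ideal property of
G-closed torsion-free classes give `Ass^G (I / ann N) = {x}` and `Supp^G (I / ann N) ⊆ Supp^G N`.
Since `I` is finitely presented it is noetherian, so induction on annihilators shows that the orbit
space is T0 (`eq_of_forall_mem_supp_iff`).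

Now let `L ⊆ M` be maximal in `P`, suppose `L ≠ M`, and choose a monoform `H ⊆ M / L` with maximal
annihilator `W` and preimage `E ⊆ M`. By maximality of `L`, the orbit `x` of `H` is not associated
to `P`. Multiplication by `W` is a morphism `t : E ⟶ [W, L]` with target in `P`; as `E` is not in
`P`, `ker t` is not contained in `L`, so `x` lies in its support. Condition (*) gives an associated
orbit `y` of `ker t` in the closure of `x`. Since `W` kills `ker t` and is the annihilator of every
nonzero subobject of `H`, every support containing `x` contains `y`. By T0, `x = y`, which is
associated to `M` and hence to `P`: a contradiction. -/

theorem factors_of_epi_comp {X A B : C} {S : Subobject X} (p : A ⟶ B) [Epi p] {f : B ⟶ X}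
    (h : S.Factors (p ≫ f)) : S.Factors f := by
  have h0 : f ≫ cokernel.π S.arrow = 0 := by
    rw [← cancel_epi p, comp_zero, ← Category.assoc, ← S.factorThru_arrow _ h, Category.assoc,
      cokernel.condition, comp_zero]
  rw [← Abelian.monoLift_comp S.arrow f h0]
  exact Subobject.factors_comp_arrow _

theorem pullback_factors_iff {X Y Z : C} (f : X ⟶ Y) (S : Subobject Y) (g : Z ⟶ X) :
    ((Subobject.pullback f).obj S).Factors g ↔ S.Factors (g ≫ f) := by
  constructor
  · intro h
    rw [← Subobject.factorThru_arrow _ _ h, Category.assoc, ← (Subobject.isPullback f S).w,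
      ← Category.assoc]
    exact Subobject.factors_comp_arrow _
  · intro h
    have := (Subobject.isPullback f S).lift_snd (S.factorThru _ h) g (S.factorThru_arrow _ h)
    rw [← this]
    exact Subobject.factors_comp_arrow _

theorem pullback_le_pullback_iff {X Y : C} (p : X ⟶ Y) [Epi p] {S T : Subobject Y} :
    (Subobject.pullback p).obj S ≤ (Subobject.pullback p).obj T ↔ S ≤ T := by
  refine ⟨fun h => ?_, fun h => (Subobject.pullback p).monotone h⟩
  have sq := Subobject.isPullback p S
  have : Epi (Subobject.pullbackπ p S) := by
    rw [← sq.isoPullback_hom_fst]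
    infer_instance
  refine Subobject.le_of_factors (factors_of_epi_comp (Subobject.pullbackπ p S) ?_)
  rw [sq.w, ← pullback_factors_iff]
  exact Subobject.factors_of_le _ h (Subobject.factors_self _)

theorem isNoetherianObject_of_epi {X Y : C} (p : X ⟶ Y) [Epi p] (hX : isNoetherianObject X) :
    isNoetherianObject Y := by
  have : WellFoundedGT (Subobject X) := hX
  exact (strictMono_of_le_iff_le fun _ _ => (pullback_le_pullback_iff p).symm).wellFoundedGT

omit [Abelian C] in
theorem isNoetherianObject_of_mono' {X Y : C} (i : X ⟶ Y) [Mono i] (hY : isNoetherianObject Y) :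
    isNoetherianObject X :=
  isNoetherianObject.prop_of_mono i hY

/-- Modular law by generalized elements: after an epi refinement `π`, an element of `B` has the same
image in `X₃` as some element `x` of `A`. Their difference comes from `X₁` and lies in `B`, hence in
`A`. -/
theorem le_of_pullback_le_of_exists_le {S : ShortComplex C} (hS : S.ShortExact)
    {A B : Subobject S.X₂} (hAB : A ≤ B)
    (h₁ : (Subobject.pullback S.f).obj B ≤ (Subobject.pullback S.f).obj A)
    (h₂ : imageSubobject (B.arrow ≫ S.g) ≤ imageSubobject (A.arrow ≫ S.g)) : B ≤ A := by
  have := hS.mono_f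
  let q := factorThruImageSubobject (A.arrow ≫ S.g)
  let b : (B : C) ⟶ (imageSubobject (A.arrow ≫ S.g) : C) :=
    factorThruImageSubobject (B.arrow ≫ S.g) ≫ Subobject.ofLE _ _ h₂
  have hb : b ≫ (imageSubobject (A.arrow ≫ S.g)).arrow = B.arrow ≫ S.g := by simp [b]
  obtain ⟨T, π, hπ, x, hx⟩ := surjective_up_to_refinements_of_epi q b
  have h0 : (π ≫ B.arrow - x ≫ A.arrow) ≫ S.g = 0 := by
    rw [Preadditive.sub_comp, Category.assoc, ← hb, reassoc_of% hx]
    simp [q]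
  let l := hS.exact.lift _ h0
  have hl : l ≫ S.f = π ≫ B.arrow - x ≫ A.arrow := hS.exact.lift_f _ h0
  have hlB : B.Factors (l ≫ S.f) := by
    rw [hl, ← Subobject.ofLE_arrow hAB, ← Category.assoc, ← Preadditive.sub_comp]
    exact Subobject.factors_comp_arrow _
  have hlA : A.Factors (l ≫ S.f) :=
    (pullback_factors_iff _ _ _).1 (Subobject.factors_of_le _ h₁ ((pullback_factors_iff _ _ _).2 hlB))
  refine Subobject.le_of_factors (factors_of_epi_comp π ?_)
  have : π ≫ B.arrow = l ≫ S.f + x ≫ A.arrow := by rw [hl]; abel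
  rw [this]
  exact Subobject.factors_add _ _ hlA (Subobject.factors_comp_arrow _)

theorem isNoetherianObject_of_shortExact {S : ShortComplex C} (hS : S.ShortExact)
    (h₁ : isNoetherianObject S.X₁) (h₃ : isNoetherianObject S.X₃) : isNoetherianObject S.X₂ := by
  have : WellFoundedGT (Subobject S.X₁) := h₁
  have : WellFoundedGT (Subobject S.X₃) := h₃
  let φ : Subobject S.X₂ → Subobject S.X₁ × Subobject S.X₃ := fun A =>
    ((Subobject.pullback S.f).obj A, imageSubobject (A.arrow ≫ S.g))
  have hφ : Monotone φ := fun A B h => by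
    refine ⟨(Subobject.pullback S.f).monotone h, ?_⟩
    refine imageSubobject_le _ (Subobject.ofLE _ _ h ≫ factorThruImageSubobject (B.arrow ≫ S.g)) ?_
    simp [φ]
  refine StrictMono.wellFoundedGT (f := φ) fun A B h => ?_
  refine lt_of_le_not_ge (hφ h.le) fun h' => h.not_ge ?_
  exact le_of_pullback_le_of_exists_le hS h.le h'.1 h'.2

theorem isNoetherianObject_sup {X : C} {S T : Subobject X} (hS : isNoetherianObject (S : C))
    (hT : isNoetherianObject (T : C)) : isNoetherianObject ((S ⊔ T : Subobject X) : C) := by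
  have hST : isNoetherianObject ((S : C) ⊞ (T : C)) :=
    isNoetherianObject_of_shortExact (ShortComplex.Splitting.ofHasBinaryBiproduct _ _).shortExact
      hS hT
  let d : (S : C) ⊞ (T : C) ⟶ X := biprod.desc S.arrow T.arrow
  have h : S ⊔ T ≤ imageSubobject d := by
    refine sup_le ?_ ?_
    · refine Subobject.le_of_comm (biprod.inl ≫ factorThruImageSubobject d) ?_
      simp [d]
    · refine Subobject.le_of_comm (biprod.inr ≫ factorThruImageSubobject d) ?_
      simp [d]
  exact isNoetherianObject_of_mono' (Subobject.ofLE _ _ h)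
    (isNoetherianObject_of_epi (factorThruImageSubobject d) hST)

theorem isNoetherianObject_map (e : C ≌ C) {X : C} (hX : isNoetherianObject X) :
    isNoetherianObject (e.functor.obj X) := by
  have : WellFoundedGT (Subobject (e.inverse.obj (e.functor.obj X))) :=
    isNoetherianObject_of_mono' (e.unitIso.app X).inv hX
  let φ : Subobject (e.functor.obj X) → Subobject (e.inverse.obj (e.functor.obj X)) := fun S =>
    Subobject.mk (e.inverse.map S.arrow)
  refine StrictMono.wellFoundedGT (f := φ) (strictMono_of_le_iff_le fun S T => ⟨fun h => ?_,
    fun h => ?_⟩)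
  · refine Subobject.mk_le_mk_of_comm (e.inverse.map (Subobject.ofLE _ _ h)) ?_
    rw [← Functor.map_comp, Subobject.ofLE_arrow]
  · refine Subobject.le_of_comm (e.inverse.preimage (Subobject.ofMkLEMk _ _ h)) ?_
    apply e.inverse.map_injective
    simp

theorem exists_mono_isNoetherianObject (h : IsLocallyNoetherian C) {X : C} (hX : ¬ IsZero X) :
    ∃ (Y : C) (i : Y ⟶ X), Mono i ∧ isNoetherianObject Y ∧ ¬ IsZero Y := by
  obtain ⟨S, -, hS, hsep⟩ := h
  by_contra! hcon
  refine hX ((IsZero.iff_id_eq_zero X).2 (hsep _ _ fun D hD d => ?_))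
  have := hcon (image d) (image.ι d) inferInstance
    (isNoetherianObject_of_epi (factorThruImage d) (hS _ hD))
  rw [Category.comp_id, comp_zero, ← image.fac d, this.eq_zero_of_src (image.ι d), comp_zero]

end Noetherian

/-! ### Finitely presented objects are noetherian -/

section FinitelyPresentable

variable {C : Type u} [Category.{v} C] [Abelian C] [IsGrothendieckAbelian.{v} C]

/-- In a locally noetherian Grothendieck category, finitely presented objects are noetherian. -/
theorem isNoetherianObject_of_isFinitelyPresentable (h : IsLocallyNoetherian C) (X : C)
    [IsFinitelyPresentable.{v} X] : isNoetherianObject X := by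
  classical
  obtain ⟨S, hsmall, hS, hsep⟩ := h
  let T := Shrink.{v} (Σ D : Subtype S, D.1 ⟶ X)
  let img : T → Subobject X := fun t => imageSubobject ((equivShrink _).symm t).2
  have himg (t : T) : isNoetherianObject (img t : C) :=
    isNoetherianObject_of_epi (factorThruImageSubobject _) (hS _ ((equivShrink _).symm t).1.2)
  let φ : Finset T → Subobject X := fun s => s.sup img
  have hφ (s : Finset T) : isNoetherianObject (φ s : C) := by
    induction s using Finset.induction_on with
    | empty =>
      exact (isNoetherianObject (C := C)).is_iff _ |>.1
        (isNoetherianObject_of_isZero ((isZero_zero C).of_iso (Subobject.botCoeIsoZero (B := X))))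
    | insert a s _ ih =>
      simp only [φ, Finset.sup_insert]
      exact isNoetherianObject_sup (himg a) ih
  have hmono : Monotone φ := fun s t hst => Finset.sup_mono hst
  -- `X` is the directed union of finite sums of images of noetherian generators: exactness of
  -- filtered colimits makes the comparison map `f` mono, and separation makes it epi.
  let F : Finset T ⥤ MonoOver X := hmono.functor ⋙ Subobject.representative
  let c := colimit.cocone (F ⋙ MonoOver.forget _ ⋙ Over.forget _)
  have hc : IsColimit c := colimit.isColimit _
  let f : c.pt ⟶ X := hc.desc (Cocone.mk X
      { app j := (F.obj j).obj.hom
        naturality {j j'} g := by simp [MonoOver.forget] })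
  have hf (j) : c.ι.app j ≫ f = (F.obj j).obj.hom := hc.fac _ _
  have : Mono f := IsGrothendieckAbelian.mono_of_isColimit_monoOver F hc f hf
  have : Epi f := by
    refine Preadditive.epi_of_cancel_zero _ fun {Z} g hg => hsep _ _ fun D hD d => ?_
    let t : T := equivShrink _ ⟨⟨D, hD⟩, d⟩
    have h1 : (φ {t}).Factors d := by
      refine Subobject.factors_of_le _ (le_of_eq (Finset.sup_singleton ..).symm : img t ≤ φ {t}) ?_
      have hd : img t = imageSubobject d :=
        congrArg (fun z : Σ D : Subtype S, D.1 ⟶ X => imageSubobject z.2)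
          (Equiv.symm_apply_apply _ _)
      have := Subobject.factors_comp_arrow (factorThruImageSubobject d)
      rwa [imageSubobject_arrow_comp, ← hd] at this
    have h2 : (φ {t}).arrow ≫ g = 0 := by
      have e : (c.ι.app {t} ≫ f) ≫ g = 0 := by rw [Category.assoc, hg, comp_zero]
      exact (congrArg (· ≫ g) (hf {t})).symm.trans e
    rw [← (φ {t}).factorThru_arrow d h1, Category.assoc, h2, comp_zero, comp_zero]
  have : IsIso f := isIso_of_mono_of_epi f
  -- Finite presentability makes the identity of `X` factor through one stage of the union.
  obtain ⟨j, p, hp⟩ := IsFinitelyPresentable.exists_hom_of_isColimit hc (inv f)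
  have : p ≫ (F.obj j).obj.hom = 𝟙 X := by
    rw [← hf, reassoc_of% hp, IsIso.inv_hom_id]
  have : Epi (φ j).arrow := epi_of_epi_fac this
  exact isNoetherianObject_of_epi (φ j).arrow (hφ j)

end FinitelyPresentable

/-! ### Monoform objects and subquotients -/

section Monoform

variable {C : Type u} [Category.{v} C] [Abelian C]

theorem lift_fst_comp_eq {X Y Z T : C} {i : X ⟶ Z} {j : Y ⟶ Z} (g : T ⟶ X) (l : T ⟶ Y)
    (h : g ≫ i = l ≫ j) (h0 : IsZero (pullback i j)) : g = 0 := by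
  rw [← pullback.lift_fst g l h, h0.eq_of_tgt (pullback.lift _ _ _) 0, zero_comp]

theorem mono_cokernel_map_comp {L K H : C} (j : L ⟶ K) (i : K ⟶ H) [Mono i] :
    Mono (cokernel.map j (j ≫ i) (𝟙 L) i (by simp)) := by
  have sq : IsPullback j (𝟙 L) i (j ≫ i) :=
    IsPullback.of_isLimit' ⟨by simp⟩ (PullbackCone.IsLimit.mk _ (fun s => s.snd)
      (fun s => by rw [← cancel_mono i, Category.assoc]; exact s.condition.symm)
      (fun s => Category.comp_id _) (fun s m _ h₂ => by simpa using h₂))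
  exact Abelian.mono_cokernel_map_of_isPullback sq

theorem mono_cokernel_desc_of_kernelSubobject_le {X Y : C} (f : X ⟶ Y) {L : Subobject X}
    (w : L.arrow ≫ f = 0) (h : kernelSubobject f ≤ L) : Mono (cokernel.desc L.arrow f w) := by
  obtain rfl : L = kernelSubobject f := (le_kernelSubobject _ _ w).antisymm h
  have : (ShortComplex.mk _ _ w).Exact := ShortComplex.exact_of_f_is_kernel _
    (IsKernel.isoKernel _ _ (kernelIsKernel f) (kernelSubobjectIso f) (by simp))
  exact this.mono_cokernelDesc

theorem IsMonoform.of_mono {H K : C} (hH : IsMonoform H) (i : K ⟶ H) [Mono i]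
    (hK : ¬ IsZero K) : IsMonoform K where
  not_isZero := hK
  not_common L j _ hL h := by
    have := mono_cokernel_map_comp j i
    exact hH.not_common L (j ≫ i) (mono_comp _ _) hL
      (h.of_mono i (cokernel.map j (j ≫ i) (𝟙 L) i _))

theorem IsMonoform.atom_eq_iff {H H' : C} (hH : IsMonoform H) (hH' : IsMonoform H') :
    hH.atom = hH'.atom ↔ HasCommonSubobject H H' :=
  Quotient.eq (r := atomSetoid C)

theorem IsMonoform.atom_of_mono {H K : C} (hH : IsMonoform H) (i : K ⟶ H) [Mono i]
    (hK : IsMonoform K) : hK.atom = hH.atom :=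
  (hK.atom_eq_iff hH).2 ⟨K, 𝟙 _, i, inferInstance, inferInstance, hK.not_isZero⟩

/-- Choose `L` maximal such that `M` and `M / L` share a nonzero subobject `Z`. If `Z` were not
monoform, some nonzero `K ⊆ Z` would make the preimage of `K` in `M` a strictly larger choice. -/
theorem exists_isMonoform_mono {M : C} (hM : isNoetherianObject M) (h0 : ¬ IsZero M) :
    ∃ (H : C) (i : H ⟶ M), Mono i ∧ IsMonoform H := by
  have : WellFoundedGT (Subobject M) := hM
  let s : Set (Subobject M) := {L | HasCommonSubobject M (cokernel L.arrow)}
  have hs : s.Nonempty := by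
    refine ⟨⊥, M, 𝟙 _, cokernel.π _, inferInstance, ?_, h0⟩
    rw [Subobject.bot_arrow]
    infer_instance
  obtain ⟨L, ⟨Z, i, j, hi, hj, hZ⟩, hL⟩ := wellFounded_gt.has_min s hs
  refine ⟨Z, i, hi, hZ, fun K k _ hK h => ?_⟩
  -- The kernel of `p` is that preimage, and `M / ker p` is `(M / L) / K`, which contains `Z / K`.
  let p : M ⟶ cokernel (k ≫ j) := cokernel.π L.arrow ≫ cokernel.π (k ≫ j)
  have := mono_cokernel_map_comp k j
  have := mono_cokernel_desc_of_kernelSubobject_le p (kernelSubobject_arrow_comp p) le_rfl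
  let d := cokernel.desc (kernelSubobject p).arrow p (kernelSubobject_arrow_comp p)
  have : Epi d := epi_of_epi_fac (cokernel.π_desc _ _ _)
  have : IsIso d := isIso_of_mono_of_epi d
  refine hL (kernelSubobject p) ?_ (lt_of_le_not_ge ?_ fun hle => ?_)
  · exact h.of_mono i (cokernel.map k (k ≫ j) (𝟙 K) j (by simp) ≫ inv d)
  · exact le_kernelSubobject _ _ (by simp [p])
  · have hw : L.arrow ≫ p = 0 := by simp [p]
    have hm := mono_cokernel_desc_of_kernelSubobject_le p hw hle
    have hd : cokernel.desc L.arrow p hw = cokernel.π (k ≫ j) := by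
      rw [← cancel_epi (cokernel.π L.arrow), cokernel.π_desc]
    rw [hd] at hm
    have h0 : k ≫ j = 0 := by rw [← cancel_mono (cokernel.π (k ≫ j)), cokernel.condition, zero_comp]
    exact hK (IsZero.of_mono_eq_zero (k ≫ j) h0)

/-- `H` is a subquotient of `M`. -/
def IsSubquotient (H M : C) : Prop := ∃ (K : C) (i : K ⟶ M) (p : K ⟶ H), Mono i ∧ Epi p

omit [Abelian C] in
theorem IsSubquotient.of_mono {X Y : C} (i : X ⟶ Y) [Mono i] : IsSubquotient X Y :=
  ⟨X, i, 𝟙 X, inferInstance, inferInstance⟩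

omit [Abelian C] in
theorem IsSubquotient.of_epi {X Y : C} (p : X ⟶ Y) [Epi p] : IsSubquotient Y X :=
  ⟨X, 𝟙 X, p, inferInstance, inferInstance⟩

theorem IsSubquotient.trans {X Y Z : C} (h₁ : IsSubquotient X Y) (h₂ : IsSubquotient Y Z) :
    IsSubquotient X Z := by
  obtain ⟨K, i, p, _, _⟩ := h₁
  obtain ⟨L, j, q, _, _⟩ := h₂
  exact ⟨pullback i q, pullback.snd i q ≫ j, pullback.fst i q ≫ p, mono_comp _ _, epi_comp _ _⟩

theorem IsSubquotient.map (e : C ≌ C) {X Y : C} (h : IsSubquotient X Y) :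
    IsSubquotient (e.functor.obj X) (e.functor.obj Y) := by
  obtain ⟨K, i, p, _, _⟩ := h
  exact ⟨_, e.functor.map i, e.functor.map p, inferInstance, inferInstance⟩

theorem IsSubquotient.isNoetherianObject {X Y : C} (h : IsSubquotient X Y)
    (hY : isNoetherianObject Y) : isNoetherianObject X := by
  obtain ⟨K, i, p, _, _⟩ := h
  exact isNoetherianObject_of_epi p (isNoetherianObject_of_mono' i hY)

theorem atomSupp_subset {X Y : C} (h : IsSubquotient X Y) : atomSupp X ⊆ atomSupp Y := by
  rintro _ ⟨H, hH, rfl, hHX⟩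
  exact ⟨H, hH, rfl, IsSubquotient.trans hHX h⟩

theorem atomAss_subset {X Y : C} (i : X ⟶ Y) [Mono i] : atomAss X ⊆ atomAss Y := by
  rintro _ ⟨H, hH, rfl, j, _⟩
  exact ⟨H, hH, rfl, j ≫ i, mono_comp _ _⟩

theorem atomAss_subset_atomSupp (X : C) : atomAss X ⊆ atomSupp X := by
  rintro _ ⟨H, hH, rfl, j, _⟩
  exact ⟨H, hH, rfl, IsSubquotient.of_mono j⟩

theorem IsMonoform.atom_mem_atomAss {H M : C} (hH : IsMonoform H) (i : H ⟶ M) [Mono i] :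
    hH.atom ∈ atomAss M :=
  ⟨H, hH, rfl, i, inferInstance⟩

theorem IsMonoform.atomAss_subset {H : C} (hH : IsMonoform H) : atomAss H ⊆ {hH.atom} := by
  rintro _ ⟨K, hK, rfl, i, _⟩
  exact hH.atom_of_mono i hK

/-- A monoform `H ⊆ X₂` either meets `X₁` trivially, and then embeds into `X₃`, or meets it in a
nonzero subobject with the same atom. -/
theorem atomAss_subset_of_shortExact {S : ShortComplex C} (hS : S.ShortExact) :
    atomAss S.X₂ ⊆ atomAss S.X₁ ∪ atomAss S.X₃ := by
  rintro _ ⟨H, hH, rfl, i, _⟩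
  have := hS.mono_f
  by_cases h0 : IsZero (pullback i S.f)
  · right
    refine ⟨H, hH, rfl, i ≫ S.g, Preadditive.mono_of_cancel_zero _ fun {T} g hg => ?_⟩
    rw [← Category.assoc] at hg
    exact lift_fst_comp_eq g _ (hS.exact.lift_f _ hg).symm h0
  · left
    exact ⟨_, hH.of_mono (pullback.fst i S.f) h0, hH.atom_of_mono (pullback.fst i S.f) _,
      pullback.snd i S.f, inferInstance⟩

theorem atomSupp_subset_of_shortExact {S : ShortComplex C} (hS : S.ShortExact) :
    atomSupp S.X₂ ⊆ atomSupp S.X₁ ∪ atomSupp S.X₃ := by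
  rintro _ ⟨H, hH, rfl, K, i, p, _, _⟩
  have := hS.mono_f
  let r : pullback i S.f ⟶ H := pullback.fst i S.f ≫ p
  by_cases h0 : r = 0
  · right
    let q : K ⟶ image (i ≫ S.g) := factorThruImage (i ≫ S.g)
    have hk : kernel.ι q ≫ p = 0 := by
      have hq : (kernel.ι q ≫ i) ≫ S.g = 0 := by
        have : q ≫ image.ι _ = i ≫ S.g := image.fac _
        rw [Category.assoc]
        exact (congrArg (kernel.ι q ≫ ·) this.symm).trans (by simp)
      rw [← pullback.lift_fst (kernel.ι q) _ (hS.exact.lift_f _ hq).symm, Category.assoc]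
      exact (congrArg _ h0).trans comp_zero
    refine ⟨H, hH, rfl, image (i ≫ S.g), image.ι _, Abelian.epiDesc q p hk, inferInstance, ?_⟩
    exact epi_of_epi_fac (Abelian.comp_epiDesc q p hk)
  · left
    have hI : ¬ IsZero (image r) := fun h => h0 <| by
      rw [← image.fac r, h.eq_of_tgt (factorThruImage r) 0, zero_comp]
    exact ⟨_, hH.of_mono (image.ι r) hI, hH.atom_of_mono (image.ι r) _, pullback i S.f,
      pullback.snd i S.f, factorThruImage r, inferInstance, inferInstance⟩

end Monoform

/-! ### Orbit supports, associated orbits and the torsion-free classes they define -/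

namespace GroupAction

variable {G : Type w} [Group G] {C : Type u} [Category.{v} C] (ρ : GroupAction G C)

/-- `g⁻¹ · (g · X)` is isomorphic to `X`. -/
theorem nonempty_inv_obj_iso (g : G) (X : C) : Nonempty (ρ.obj g⁻¹ (ρ.obj g X) ≅ X) := by
  obtain ⟨e⟩ := ρ.one_iso
  obtain ⟨f⟩ := ρ.mul_iso g⁻¹ g
  rw [inv_mul_cancel] at f
  exact ⟨(f.app X).symm ≪≫ e.app X⟩

variable [Abelian C]

theorem proj_eq_iff {α β : AtomSpectrum C} : ρ.proj α = ρ.proj β ↔ ∃ g, ρ.smulAtom g α = β :=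
  Quotient.eq (r := ρ.orbitSetoid)

theorem proj_atom_map (g : G) {H : C} (hH : IsMonoform H) :
    ρ.proj (hH.map (ρ.equiv g)).atom = ρ.proj hH.atom :=
  (ρ.proj_eq_iff (α := hH.atom).2 ⟨g, rfl⟩).symm

theorem ass_subset {X Y : C} (i : X ⟶ Y) [Mono i] : ρ.ass X ⊆ ρ.ass Y :=
  Set.image_mono (atomAss_subset i)

theorem supp_subset {X Y : C} (h : IsSubquotient X Y) : ρ.supp X ⊆ ρ.supp Y :=
  Set.image_mono (atomSupp_subset h)

theorem ass_subset_supp (X : C) : ρ.ass X ⊆ ρ.supp X :=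
  Set.image_mono (atomAss_subset_atomSupp X)

theorem ass_obj (g : G) (X : C) : ρ.ass (ρ.obj g X) = ρ.ass X := by
  have key (g : G) (X : C) : ρ.ass X ⊆ ρ.ass (ρ.obj g X) := by
    rintro _ ⟨_, ⟨H, hH, rfl, i, _⟩, rfl⟩
    exact ⟨_, (hH.map (ρ.equiv g)).atom_mem_atomAss ((ρ.equiv g).functor.map i),
      ρ.proj_atom_map g hH⟩
  obtain ⟨f⟩ := ρ.nonempty_inv_obj_iso g X
  exact ((key g⁻¹ _).trans (ρ.ass_subset f.hom)).antisymm (key g X)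

theorem supp_obj (g : G) (X : C) : ρ.supp (ρ.obj g X) = ρ.supp X := by
  have key (g : G) (X : C) : ρ.supp X ⊆ ρ.supp (ρ.obj g X) := by
    rintro _ ⟨_, ⟨H, hH, rfl, h⟩, rfl⟩
    exact ⟨_, ⟨_, hH.map (ρ.equiv g), rfl, IsSubquotient.map (ρ.equiv g) h⟩,
      ρ.proj_atom_map g hH⟩
  obtain ⟨f⟩ := ρ.nonempty_inv_obj_iso g X
  exact ((key g⁻¹ _).trans (ρ.supp_subset (IsSubquotient.of_mono f.hom))).antisymm (key g X)

theorem isOpen_supp (M : C) : IsOpen (ρ.supp M) := by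
  refine isQuotientMap_quotient_mk'.isOpen_preimage.1 ?_
  -- The saturation of a support is the union of the supports of the translates.
  have : ρ.proj ⁻¹' ρ.supp M = ⋃ g : G, atomSupp (ρ.obj g M) := by
    ext α
    simp only [Set.mem_preimage, Set.mem_iUnion]
    constructor
    · rintro ⟨_, ⟨H, hH, rfl, h⟩, hα⟩
      obtain ⟨g, rfl⟩ := ρ.proj_eq_iff.1 hα
      exact ⟨g, _, hH.map (ρ.equiv g), rfl, IsSubquotient.map (ρ.equiv g) h⟩
    · rintro ⟨g, hg⟩
      rw [← ρ.supp_obj g]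
      exact ⟨α, hg, rfl⟩
  change IsOpen (ρ.proj ⁻¹' ρ.supp M)
  rw [this]
  exact isOpen_iUnion fun g => TopologicalSpace.isOpen_generateFrom_of_mem ⟨_, rfl⟩

/-- Two monoform objects lie in the same orbit if and only if a translate of one of them has a
common nonzero subobject with the other. -/
theorem proj_atom_eq_iff {H K : C} (hH : IsMonoform H) (hK : IsMonoform K) :
    ρ.proj hH.atom = ρ.proj hK.atom ↔ ∃ g, HasCommonSubobject (ρ.obj g H) K :=
  ρ.proj_eq_iff.trans (exists_congr fun g => (hH.map (ρ.equiv g)).atom_eq_iff hK)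

/-- If two monoform objects lie in the same orbit, then a nonzero subobject of the first has a
translate that embeds into the second. -/
theorem exists_mono_obj_mono {H K : C} (hH : IsMonoform H) (hK : IsMonoform K)
    (h : ρ.proj hH.atom = ρ.proj hK.atom) :
    ∃ (g : G) (H' : C) (i : H' ⟶ H) (j : ρ.obj g H' ⟶ K), Mono i ∧ Mono j ∧ ¬ IsZero H' := by
  obtain ⟨g, T, s, t, _, _, hT⟩ := (ρ.proj_atom_eq_iff hH hK).1 h
  obtain ⟨f⟩ := ρ.nonempty_inv_obj_iso g H
  obtain ⟨f'⟩ := ρ.nonempty_inv_obj_iso g⁻¹ T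
  rw [inv_inv] at f'
  exact ⟨g, ρ.obj g⁻¹ T, (ρ.equiv g⁻¹).functor.map s ≫ f.hom, f'.hom ≫ t, mono_comp _ _,
    mono_comp _ _, not_isZero_map _ hT⟩

theorem mem_ass_iff {M : C} {x : ρ.OrbitSpectrum} :
    x ∈ ρ.ass M ↔ ∃ (H : C) (i : H ⟶ M) (hH : IsMonoform H), Mono i ∧ ρ.proj hH.atom = x := by
  constructor
  · rintro ⟨_, ⟨H, hH, rfl, i, hi⟩, rfl⟩
    exact ⟨H, i, hH, hi, rfl⟩
  · rintro ⟨H, i, hH, hi, rfl⟩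
    exact ⟨_, ⟨H, hH, rfl, i, hi⟩, rfl⟩

theorem mem_supp_iff {M : C} {x : ρ.OrbitSpectrum} :
    x ∈ ρ.supp M ↔ ∃ (H : C) (hH : IsMonoform H), IsSubquotient H M ∧ ρ.proj hH.atom = x := by
  constructor
  · rintro ⟨_, ⟨H, hH, rfl, h⟩, rfl⟩
    exact ⟨H, hH, h, rfl⟩
  · rintro ⟨H, hH, h, rfl⟩
    exact ⟨_, ⟨H, hH, rfl, h⟩, rfl⟩

/-- Abstracts what `ass` and `supp` have in common. The `supp` instance is needed as well, so that
the Hom ideal property also controls supports of internal Homs. -/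
theorem isNoethTorsionFree_and_isGClosed (s : C → Set ρ.OrbitSpectrum)
    (hs : ∀ {X Y : C} (i : X ⟶ Y) [Mono i], s X ⊆ s Y) (hz : ∀ X, s X ⊆ ρ.supp X)
    (hext : ∀ {S : ShortComplex C}, S.ShortExact → s S.X₂ ⊆ s S.X₁ ∪ s S.X₃)
    (hg : ∀ g X, s (ρ.obj g X) = s X) (Φ : Set ρ.OrbitSpectrum) :
    (fun M => isNoetherianObject M ∧ s M ⊆ Φ) ∈ torfG ρ := by
  refine ⟨⟨fun _ h => h.1, ⟨_, isZero_zero C, ?_, ?_⟩, ⟨fun i _ h => ?_⟩, ⟨fun hS h₁ h₃ => ?_⟩⟩,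
    fun g X h => ?_⟩
  · exact ((isNoetherianObject (C := C)).is_iff _).1 (isNoetherianObject_of_isZero (isZero_zero C))
  · rintro x hx
    obtain ⟨H, hH, ⟨K, i, p, _, _⟩, rfl⟩ := ρ.mem_supp_iff.1 (hz _ hx)
    exact absurd (IsZero.of_epi p (IsZero.of_mono i (isZero_zero C))) hH.not_isZero
  · exact ⟨isNoetherianObject_of_mono' i h.1, (hs i).trans h.2⟩
  · exact ⟨isNoetherianObject_of_shortExact hS h₁.1 h₃.1,
      (hext hS).trans (Set.union_subset h₁.2 h₃.2)⟩
  · exact ⟨isNoetherianObject_map _ h.1, (hg g X).trans_subset h.2⟩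

theorem assInv_mem_torfG (Φ : Set ρ.OrbitSpectrum) : ρ.assInv Φ ∈ torfG ρ := by
  refine ρ.isNoethTorsionFree_and_isGClosed ρ.ass (fun i _ => ρ.ass_subset i) ρ.ass_subset_supp
    (fun hS => ?_) ρ.ass_obj Φ
  simp only [ass, ← Set.image_union]
  exact Set.image_mono (atomAss_subset_of_shortExact hS)

theorem suppInv_mem_torfG (Φ : Set ρ.OrbitSpectrum) :
    (fun M : C => isNoetherianObject M ∧ ρ.supp M ⊆ Φ) ∈ torfG ρ := by
  refine ρ.isNoethTorsionFree_and_isGClosed ρ.supp (fun i _ => ρ.supp_subset (.of_mono i))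
    (fun _ => subset_rfl) (fun hS => ?_) ρ.supp_obj Φ
  simp only [supp, ← Set.image_union]
  exact Set.image_mono (atomSupp_subset_of_shortExact hS)

/-- In a locally noetherian category every orbit is represented by a noetherian monoform object. -/
theorem exists_isNoetherianObject_isMonoform (h : IsLocallyNoetherian C) (x : ρ.OrbitSpectrum) :
    ∃ (H : C) (hH : IsMonoform H), isNoetherianObject H ∧ ρ.proj hH.atom = x := by
  obtain ⟨α, rfl⟩ := Quotient.exists_rep x
  obtain ⟨⟨H, hH⟩, rfl⟩ := Quotient.exists_rep α
  obtain ⟨K, i, _, hK, hK0⟩ := exists_mono_isNoetherianObject h hH.not_isZero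
  exact ⟨K, hH.of_mono i hK0, hK, congrArg ρ.proj (hH.atom_of_mono i _)⟩

theorem assOf_assInv (h : IsLocallyNoetherian C) (Φ : Set ρ.OrbitSpectrum) :
    ρ.assOf (ρ.assInv Φ) = Φ := by
  refine (Set.iUnion₂_subset fun X hX => hX.2).antisymm fun x hx => ?_
  obtain ⟨H, hH, hHn, rfl⟩ := ρ.exists_isNoetherianObject_isMonoform h x
  refine Set.mem_iUnion₂.2 ⟨H, ⟨hHn, ?_⟩, _, hH.atom_mem_atomAss (𝟙 H), rfl⟩
  rintro _ ⟨α, hα, rfl⟩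
  rwa [hH.atomAss_subset hα]

end GroupAction

/-! ### Annihilators -/

section Annihilator

variable {C : Type u} [Category.{v} C] [Abelian C] [MonoidalCategory C] [MonoidalClosed C]

/-- The morphism `I ⟶ [P, P]` corresponding to the identity of `P`. -/
def unitToEnd (P : C) : 𝟙_ C ⟶ (ihom P).obj P := MonoidalClosed.curry (ρ_ P).hom

/-- The annihilator of `P`, the kernel of `I ⟶ [P, P]`. -/
noncomputable def annihilator (P : C) : Subobject (𝟙_ C) := kernelSubobject (unitToEnd P)

theorem curry_eq_zero_iff {P X Y : C} (f : P ⊗ X ⟶ Y) : MonoidalClosed.curry f = 0 ↔ f = 0 := by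
  have h : MonoidalClosed.curry (0 : P ⊗ X ⟶ Y) = 0 := by
    have := MonoidalClosed.curry_natural_left (0 : X ⟶ X) (0 : P ⊗ X ⟶ Y)
    rwa [comp_zero, zero_comp] at this
  rw [← h]
  exact MonoidalClosed.curry_injective.eq_iff

theorem comp_unitToEnd_eq_zero_iff {P X : C} (f : X ⟶ 𝟙_ C) :
    f ≫ unitToEnd P = 0 ↔ P ◁ f = 0 := by
  rw [unitToEnd, ← MonoidalClosed.curry_natural_left, curry_eq_zero_iff]
  exact ⟨fun h => by rwa [← cancel_mono (ρ_ P).hom, zero_comp], fun h => by rw [h, zero_comp]⟩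

theorem le_annihilator_iff {P : C} {W : Subobject (𝟙_ C)} :
    W ≤ annihilator P ↔ P ◁ W.arrow = 0 := by
  rw [← comp_unitToEnd_eq_zero_iff]
  refine ⟨fun h => ?_, fun h => le_kernelSubobject _ _ h⟩
  rw [← Subobject.ofLE_arrow h, Category.assoc]
  exact (congrArg _ (kernelSubobject_arrow_comp (unitToEnd P))).trans comp_zero

theorem unitToEnd_ne_zero {P : C} (hP : ¬ IsZero P) : unitToEnd P ≠ 0 := fun h => by
  rw [unitToEnd, curry_eq_zero_iff] at h
  rw [IsZero.iff_id_eq_zero, ← cancel_epi (ρ_ P).hom, Category.comp_id, h, zero_comp] at hP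
  exact hP rfl

/-- Tensoring need not preserve monomorphisms, but vanishing is tested in `P ⊗ I ≅ P`, where `i`
stays mono. -/
theorem annihilator_le_of_mono {P Q : C} (i : P ⟶ Q) [Mono i] : annihilator Q ≤ annihilator P := by
  rw [le_annihilator_iff]
  have : Mono (i ▷ 𝟙_ C) := by
    rw [whiskerRight_id]
    infer_instance
  rw [← cancel_mono (i ▷ 𝟙_ C), whisker_exchange, le_annihilator_iff.1 le_rfl, comp_zero, zero_comp]

omit [Abelian C] in
theorem epi_whiskerRight [BraidedCategory C] {P Q : C} (p : P ⟶ Q) [Epi p] (X : C) :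
    Epi (p ▷ X) := by
  have : (tensorLeft X).IsLeftAdjoint := ⟨_, ⟨ihom.adjunction X⟩⟩
  have : Epi (X ◁ p) := inferInstanceAs (Epi ((tensorLeft X).map p))
  have h : p ▷ X = (β_ P X).hom ≫ X ◁ p ≫ (β_ Q X).inv := by
    rw [← BraidedCategory.braiding_naturality_left_assoc, Iso.hom_inv_id, Category.comp_id]
  rw [h]
  infer_instance

/-- Here vanishing is tested on the source: tensoring is a left adjoint, so it keeps `p` epi. -/
theorem annihilator_le_of_epi [BraidedCategory C] {P Q : C} (p : P ⟶ Q) [Epi p] :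
    annihilator P ≤ annihilator Q := by
  rw [le_annihilator_iff]
  have := epi_whiskerRight p
  rw [← cancel_epi (p ▷ _), ← whisker_exchange, le_annihilator_iff.1 le_rfl, comp_zero, zero_comp]

theorem le_annihilator_cokernel [BraidedCategory C] (W : Subobject (𝟙_ C)) :
    W ≤ annihilator (cokernel W.arrow) := by
  rw [le_annihilator_iff]
  have := epi_whiskerRight (cokernel.π W.arrow)
  rw [← cancel_epi (cokernel.π W.arrow ▷ _), ← whisker_exchange]
  simp [unitors_inv_equal]

theorem annihilator_le_of_isSubquotient [BraidedCategory C] {P Q : C} (h : IsSubquotient Q P) :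
    annihilator P ≤ annihilator Q := by
  obtain ⟨K, i, p, _, _⟩ := h
  exact (annihilator_le_of_mono i).trans (annihilator_le_of_epi p)

/-- The quotient of the unit by the annihilator of `P` embeds into `[P, P]`. -/
theorem exists_mono_cokernel_annihilator (P : C) :
    ∃ i : cokernel (annihilator P).arrow ⟶ (ihom P).obj P, Mono i :=
  ⟨_, mono_cokernel_desc_of_kernelSubobject_le _ (kernelSubobject_arrow_comp (unitToEnd P)) le_rfl⟩

theorem not_isZero_cokernel_annihilator {P : C} (hP : ¬ IsZero P) :
    ¬ IsZero (cokernel (annihilator P).arrow) := fun h => by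
  refine unitToEnd_ne_zero hP ?_
  rw [← cokernel.π_desc (annihilator P).arrow (unitToEnd P) (kernelSubobject_arrow_comp _),
    h.eq_of_tgt (cokernel.π _) 0, zero_comp]

omit [MonoidalCategory C] [MonoidalClosed C] in
theorem isSubquotient_cokernel_of_le {X : C} {W W' : Subobject X} (h : W ≤ W') :
    IsSubquotient (cokernel W'.arrow) (cokernel W.arrow) := by
  let p : cokernel W.arrow ⟶ cokernel W'.arrow := cokernel.desc _ (cokernel.π W'.arrow) (by
    rw [← Subobject.ofLE_arrow h, Category.assoc, cokernel.condition, comp_zero])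
  have : Epi p := epi_of_epi_fac (cokernel.π_desc _ _ _)
  exact .of_epi p

end Annihilator

/-! ### Orbits are determined by annihilators and separated by supports -/

namespace GroupAction

variable {G : Type w} [Group G] {C : Type u} [Category.{v} C] [Abelian C] [MonoidalCategory C]
  [MonoidalClosed C] {ρ : GroupAction G C}

/-- The class `assInv` of the orbit of `P` is a Hom ideal, so it contains `[P, P]` and its subobject
`I / ann P`. The latter is nonzero, so it has an associated orbit, and only one is allowed. -/
theorem ass_cokernel_annihilator (hTorf : torfHom C = torfG ρ) {P : C} (hP : IsMonoform P)
    (hPn : isNoetherianObject P) : ρ.ass (cokernel (annihilator P).arrow) = {ρ.proj hP.atom} := by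
  have h : ρ.assInv {ρ.proj hP.atom} ∈ torfHom C := hTorf ▸ ρ.assInv_mem_torfG _
  have hE : ρ.assInv {ρ.proj hP.atom} ((ihom P).obj P) := h.2 P P ⟨hPn, by
    rintro _ ⟨α, hα, rfl⟩
    rw [hP.atomAss_subset hα]
    rfl⟩ hPn
  obtain ⟨i, _⟩ := exists_mono_cokernel_annihilator P
  have hsub := (ρ.ass_subset i).trans hE.2
  obtain ⟨H, j, _, hH⟩ := exists_isMonoform_mono (isNoetherianObject_of_mono' i hE.1)
    (not_isZero_cokernel_annihilator hP.not_isZero)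
  have hm : ρ.proj hH.atom ∈ ρ.ass (cokernel (annihilator P).arrow) :=
    ⟨_, hH.atom_mem_atomAss j, rfl⟩
  refine hsub.antisymm (Set.singleton_subset_iff.2 ?_)
  rwa [← Set.mem_singleton_iff.1 (hsub hm)]

theorem supp_cokernel_annihilator_subset (hTorf : torfHom C = torfG ρ) {P : C}
    (hPn : isNoetherianObject P) : ρ.supp (cokernel (annihilator P).arrow) ⊆ ρ.supp P := by
  have h : (fun M : C => isNoetherianObject M ∧ ρ.supp M ⊆ ρ.supp P) ∈ torfHom C :=
    hTorf ▸ ρ.suppInv_mem_torfG _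
  obtain ⟨i, _⟩ := exists_mono_cokernel_annihilator P
  exact (ρ.supp_subset (.of_mono i)).trans (h.2 P P ⟨hPn, subset_rfl⟩ hPn).2

/-- Orbits contained in the same supports are equal. -/
theorem eq_of_forall_mem_supp_iff [BraidedCategory C] (hN : IsLocallyNoetherian C)
    (hI : isNoetherianObject (𝟙_ C)) (hTorf : torfHom C = torfG ρ) {x y : ρ.OrbitSpectrum}
    (h : ∀ M : C, x ∈ ρ.supp M ↔ y ∈ ρ.supp M) : x = y := by
  have : WellFoundedGT (Subobject (𝟙_ C)) := hI
  -- Both orbits are quantified inside the induction because their roles are exchanged at each step.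
  have key (W : Subobject (𝟙_ C)) : ∀ {x y : ρ.OrbitSpectrum},
      (∀ M : C, x ∈ ρ.supp M ↔ y ∈ ρ.supp M) → ∀ (P : C) (hP : IsMonoform P),
      isNoetherianObject P → ρ.proj hP.atom = x → annihilator P = W → x = y := by
    induction W using WellFoundedGT.induction with
    | _ W ih =>
      rintro _ y hxy P hP hPn rfl rfl
      by_contra hne
      have hass := ass_cokernel_annihilator hTorf hP hPn
      have hy : y ∈ ρ.supp (cokernel (annihilator P).arrow) :=
        (hxy _).1 (ρ.ass_subset_supp _ (hass ▸ rfl))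
      obtain ⟨H, hH, hHs, rfl⟩ := ρ.mem_supp_iff.1 hy
      have hHn : isNoetherianObject H :=
        hHs.isNoetherianObject (isNoetherianObject_of_epi (cokernel.π _) hI)
      have hle : annihilator P ≤ annihilator H := by
        exact (le_annihilator_cokernel _).trans (annihilator_le_of_isSubquotient hHs)
      -- Equal annihilators force equal orbits, by `ass_cokernel_annihilator`. Otherwise the
      -- annihilator has grown, and induction applies to the pair with `y` first.
      refine hne (ih (annihilator H) (lt_of_le_of_ne hle fun heq => hne ?_)
        (fun M => (hxy M).symm) H hH hHn rfl rfl).symm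
      have := ass_cokernel_annihilator hTorf hH hHn
      rw [← heq, hass] at this
      exact Set.singleton_injective this
  obtain ⟨P, hP, hPn, hx⟩ := ρ.exists_isNoetherianObject_isMonoform hN x
  exact key _ h P hP hPn hx rfl

end GroupAction
-- Maximal subobjects in a torsion-free class
section TorsionFree

variable {C : Type u} [Category.{v} C] [Abelian C]

/-- The preimage in `M` of a subobject of `M / L` is an extension of that subobject by `L`. -/
theorem exists_shortExact_preimage {M K : C} (L : Subobject M) (h : K ⟶ cokernel L.arrow)
    [Mono h] : ∃ (E : C) (f : (L : C) ⟶ E) (q : E ⟶ K) (w : f ≫ q = 0) (a : E ⟶ M),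
      (ShortComplex.mk f q w).ShortExact ∧ Mono a ∧ f ≫ a = L.arrow ∧
        a ≫ cokernel.π L.arrow = q ≫ h := by
  let f : (L : C) ⟶ pullback (cokernel.π L.arrow) h := pullback.lift L.arrow 0 (by simp)
  have hf : f ≫ pullback.fst _ _ = L.arrow := pullback.lift_fst _ _ _
  have hw : f ≫ pullback.snd _ _ = 0 := pullback.lift_snd _ _ _
  have : Mono f := mono_of_mono_fac hf
  refine ⟨_, f, pullback.snd _ _, hw, pullback.fst _ _, ⟨?_⟩, inferInstance, hf,
    pullback.condition⟩
  refine ShortComplex.exact_of_f_is_kernel _ (KernelFork.IsLimit.ofι' _ _ fun {A} k hk => ?_)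
  have hk' : (k ≫ pullback.fst _ _) ≫ cokernel.π L.arrow = 0 := by
    rw [Category.assoc, pullback.condition, reassoc_of% hk, zero_comp]
  refine ⟨Abelian.monoLift L.arrow _ hk', ?_⟩
  rw [← cancel_mono (pullback.fst (cokernel.π L.arrow) h)]
  exact (Category.assoc _ _ _).trans ((congrArg _ hf).trans (Abelian.monoLift_comp _ _ _))

/-- For a maximal subobject `L` of `M` lying in a torsion-free class, no nonzero subobject of
`M / L` has its preimage in that class. -/
theorem exists_maximal_subobject {P : ObjectProperty C} (hP : IsNoethTorsionFree P) {M : C}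
    (hM : isNoetherianObject M) : ∃ L : Subobject M, P (L : C) ∧
      ∀ {E K : C} (h : K ⟶ cokernel L.arrow) (q : E ⟶ K) (f : (L : C) ⟶ E) (a : E ⟶ M), Mono h →
        Epi q → Mono a → f ≫ a = L.arrow → a ≫ cokernel.π L.arrow = q ≫ h → ¬ IsZero K → ¬ P E := by
  have := hP.zero
  have := hP.subobjects
  have : WellFoundedGT (Subobject M) := hM
  obtain ⟨Z, hZ, hPZ⟩ := P.exists_prop_of_containsZero
  obtain ⟨L, hPL, hL⟩ := wellFounded_gt.has_min {L : Subobject M | P (L : C)}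
    ⟨⊥, P.prop_of_mono (Subobject.botCoeIsoZero.hom ≫ hZ.isoZero.inv) hPZ⟩
  refine ⟨L, hPL, fun {E K} h q f a _ _ _ hf ha hK hPE => ?_⟩
  refine hL (Subobject.mk a) (P.prop_of_mono (Subobject.underlyingIso a).hom hPE)
    (lt_of_le_not_ge (Subobject.le_mk_of_comm f hf) fun hle => hK ?_)
  have h0 : a ≫ cokernel.π L.arrow = 0 := by
    rw [← Subobject.ofMkLE_arrow hle, Category.assoc, cokernel.condition, comp_zero]
  refine IsZero.of_mono_eq_zero h ?_
  rw [← cancel_epi q, ← ha, h0, comp_zero]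

end TorsionFree

/-! ### Multiplication by an annihilator on an extension -/

section Annihilator

variable {C : Type u} [Category.{v} C] [Abelian C] [MonoidalCategory C] [BraidedCategory C]
  [MonoidalClosed C]

/-- For an extension `E` of `H` by `L`, multiplication by the annihilator `W` of `H` gives a
morphism `E ⟶ [W, L]` whose kernel is annihilated by `W`. -/
theorem exists_hom_ihom_annihilator {S : ShortComplex C} (hS : S.ShortExact) :
    ∃ t : S.X₂ ⟶ (ihom (annihilator S.X₃ : C)).obj S.X₁,
      annihilator S.X₃ ≤ annihilator (kernel t) := by
  have := hS.mono_f
  let a := (annihilator S.X₃).arrow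
  -- The annihilator acts as zero on `X₃`, so its action on `X₂` takes values in `X₁`.
  have h0 : (S.X₂ ◁ a ≫ (ρ_ S.X₂).hom) ≫ S.g = 0 := by
    rw [Category.assoc, ← rightUnitor_naturality, whisker_exchange_assoc,
      le_annihilator_iff.1 le_rfl, zero_comp, comp_zero]
  let m := hS.exact.lift _ h0
  have hm : m ≫ S.f = S.X₂ ◁ a ≫ (ρ_ S.X₂).hom := hS.exact.lift_f _ h0
  let t := MonoidalClosed.curry ((β_ _ S.X₂).hom ≫ m)
  refine ⟨t, ?_⟩
  have ht := kernel.condition t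
  rw [← MonoidalClosed.curry_natural_left, curry_eq_zero_iff,
    BraidedCategory.braiding_naturality_right_assoc, ← cancel_epi (β_ _ _).inv,
    Iso.inv_hom_id_assoc, comp_zero] at ht
  have := congrArg (· ≫ S.f) ht
  simp only [Category.assoc, hm, zero_comp, ← whisker_exchange_assoc] at this
  rw [rightUnitor_naturality, ← Category.assoc] at this
  rw [le_annihilator_iff, ← cancel_mono (ρ_ _).hom, zero_comp, ← cancel_mono (kernel.ι t), zero_comp]
  exact this

end Annihilator

/-! ### A torsion-free class is recovered from its associated orbits -/

namespace GroupAction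

variable {G : Type w} [Group G] {C : Type u} [Category.{v} C] [Abelian C] [MonoidalCategory C]
  [BraidedCategory C] [MonoidalClosed C] {ρ : GroupAction G C}

theorem prop_of_ass_subset_assOf (hN : IsLocallyNoetherian C) (hI : isNoetherianObject (𝟙_ C))
    (hTorf : torfHom C = torfG ρ)
    (hStar : ∀ (M : C), ∀ x ∈ ρ.supp M, ∃ y ∈ ρ.ass M, y ∈ closure {x})
    {P : ObjectProperty C} (hP : P ∈ torfG ρ) {M : C} (hM : isNoetherianObject M)
    (hass : ρ.ass M ⊆ ρ.assOf P) : P M := by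
  have := hP.1.subobjects
  have := hP.1.extensions
  have : WellFoundedGT (Subobject (𝟙_ C)) := hI
  obtain ⟨L, hPL, hL⟩ := exists_maximal_subobject hP.1 hM
  by_contra hPM
  have hQ : ¬ IsZero (cokernel L.arrow) := fun h0 => by
    have : Epi L.arrow := Preadditive.epi_of_isZero_cokernel _ h0
    have : IsIso L.arrow := isIso_of_mono_of_epi _
    exact hPM (P.prop_of_mono (inv L.arrow) hPL)
  obtain ⟨H₀, h₀, hh₀, hH₀⟩ :=
    exists_isMonoform_mono (isNoetherianObject_of_epi (cokernel.π L.arrow) hM) hQ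
  obtain ⟨_, ⟨H, h, hh, hH, rfl⟩, hmax⟩ := wellFounded_gt.has_min
    {W | ∃ (H : C) (h : H ⟶ cokernel L.arrow), Mono h ∧ IsMonoform H ∧ annihilator H = W}
    ⟨_, H₀, h₀, hh₀, hH₀, rfl⟩
  -- Passing to subobjects can only enlarge the annihilator, which is already maximal.
  have hann {H' : C} (i : H' ⟶ H) [Mono i] (h0 : ¬ IsZero H') : annihilator H' = annihilator H :=
    ((annihilator_le_of_mono i).eq_of_not_lt
      (hmax _ ⟨H', i ≫ h, mono_comp _ _, hH.of_mono i h0, rfl⟩)).symm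
  have hHn : isNoetherianObject H :=
    isNoetherianObject_of_mono' h (isNoetherianObject_of_epi (cokernel.π L.arrow) hM)
  have hβ : ρ.proj hH.atom ∉ ρ.assOf P := fun hβ => by
    obtain ⟨X, hPX, hX⟩ := Set.mem_iUnion₂.1 hβ
    obtain ⟨K, k, hK, _, hKH⟩ := ρ.mem_ass_iff.1 hX
    obtain ⟨g, H', i, j, _, _, h0⟩ := ρ.exists_mono_obj_mono hK hH hKH
    obtain ⟨E, f, q, w, a, hS, ha, hfa, haq⟩ := exists_shortExact_preimage L (j ≫ h)
    have := hS.epi_g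
    refine hL (j ≫ h) q f a (mono_comp _ _) this ha hfa haq (not_isZero_map _ h0)
      -- The preimage of `g · H'` is an extension of two objects of `P`, against the maximality of
      -- `L`.
      (P.prop_X₂_of_shortExact hS hPL (hP.2 g H' (P.prop_of_mono (i ≫ k) hPX)))
  obtain ⟨E, f, q, w, a, hS, ha, hfa, haq⟩ := exists_shortExact_preimage L h
  obtain ⟨t, ht⟩ := exists_hom_ihom_annihilator hS
  have := hS.mono_f
  have := hS.epi_g
  have hPW : P ((ihom (annihilator H : C)).obj (L : C)) := (hTorf ▸ hP : P ∈ torfHom C).2 _ _ hPL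
    (isNoetherianObject_of_mono' (annihilator H).arrow hI)
  have hPE : ¬ P E := hL h q f a hh this ha hfa haq hH.not_isZero
  -- Otherwise `ker t` embeds into `L`, and `E` is an extension of a subobject of `[W, L]` by a
  -- subobject of `L`.
  have hn : kernel.ι t ≫ q ≠ 0 := fun h0 => hPE <| by
    have hl := hS.exact.lift_f (kernel.ι t) h0
    have : Mono (hS.exact.lift (kernel.ι t) h0) := mono_of_mono_fac hl
    have hE : (ShortComplex.mk (kernel.ι t) (cokernel.π (kernel.ι t)) (by simp)).ShortExact :=
      { exact := ShortComplex.exact_of_g_is_cokernel _ (cokernelIsCokernel _) }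
    exact P.prop_X₂_of_shortExact hE (P.prop_of_mono (hS.exact.lift (kernel.ι t) h0) hPL)
      (P.prop_of_mono (Abelian.factorThruCoimage t) hPW)
  have hs : ρ.proj hH.atom ∈ ρ.supp (kernel t) := by
    have h0 : ¬ IsZero (image (kernel.ι t ≫ q)) := fun h0 => hn <| by
      rw [← image.fac (kernel.ι t ≫ q), h0.eq_of_tgt (factorThruImage _) 0, zero_comp]
    exact ρ.mem_supp_iff.2 ⟨_, hH.of_mono (image.ι _) h0, .of_epi (factorThruImage _),
      congrArg ρ.proj (hH.atom_of_mono (image.ι _) _)⟩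
  obtain ⟨y, hy, hcl⟩ := hStar _ _ hs
  obtain ⟨Y, i, hY, _, hYy⟩ := ρ.mem_ass_iff.1 hy
  have hYn : isNoetherianObject Y := isNoetherianObject_of_mono' (i ≫ kernel.ι t ≫ a) hM
  refine hβ ?_
  suffices ρ.proj hH.atom = y from this ▸ hass (ρ.ass_subset (kernel.ι t ≫ a) hy)
  refine eq_of_forall_mem_supp_iff hN hI hTorf fun Z => ⟨fun hZ => ?_, fun hZ => ?_⟩
  · obtain ⟨K, hK, hKZ, hKH⟩ := ρ.mem_supp_iff.1 hZ
    obtain ⟨g, H', j, k, _, _, h0⟩ := ρ.exists_mono_obj_mono hH hK hKH.symm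
    -- Hence `I / ann Y` is a quotient of `I / ann H'`, which carries `y` into the support of `H'`,
    -- and then of `g · H'` and `Z`.
    have hle : annihilator H' ≤ annihilator Y :=
      (hann j h0).trans_le (ht.trans (annihilator_le_of_mono i))
    have h1 : y ∈ ρ.supp (cokernel (annihilator Y).arrow) :=
      ρ.ass_subset_supp _ (by rw [ass_cokernel_annihilator hTorf hY hYn, hYy]; rfl)
    have h2 : y ∈ ρ.supp H' := supp_cokernel_annihilator_subset hTorf
      (isNoetherianObject_of_mono' j hHn) (ρ.supp_subset (isSubquotient_cokernel_of_le hle) h1)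
    rw [← ρ.supp_obj g] at h2
    exact ρ.supp_subset ((IsSubquotient.of_mono k).trans hKZ) h2
  -- This direction is the closure condition: an open set containing `y` contains the orbit of `H`.
  · obtain ⟨_, hz, rfl⟩ := mem_closure_iff.1 hcl _ (ρ.isOpen_supp Z) hZ
    exact hz

end GroupAction

end OrbitAtom

theorem mainTheorem2 {C : Type u} [Category.{v} C] [Abelian C] [IsGrothendieckAbelian.{v} C]
    [MonoidalCategory C] [SymmetricCategory C] [MonoidalClosed C]
    {G : Type w} [Group G] (ρ : OrbitAtom.GroupAction G C)
    (hNoeth : OrbitAtom.IsLocallyNoetherian C)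
    (hC1 : IsFinitelyPresentable.{v} (𝟙_ C))
    (hC2 : OrbitAtom.GeneratedBy (OrbitAtom.IsDualizable (C := C)))
    (hLoc : OrbitAtom.locTensor C = OrbitAtom.locG ρ)
    (hTorf : OrbitAtom.torfHom C = OrbitAtom.torfG ρ)
    (hStar : ∀ (M : C), ∀ x ∈ ρ.supp M, ∃ y ∈ ρ.ass M, y ∈ closure {x}) :
    ∃ e : OrbitAtom.torfG ρ ≃o Set ρ.OrbitSpectrum,
      (∀ P : OrbitAtom.torfG ρ, e P = ρ.assOf P.1) ∧
      (∀ Φ : Set ρ.OrbitSpectrum, (e.symm Φ).1 = ρ.assInv Φ) := by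
  have hI := OrbitAtom.isNoetherianObject_of_isFinitelyPresentable hNoeth (𝟙_ C)
  have hinv (P : OrbitAtom.torfG ρ) : ρ.assInv (ρ.assOf P.1) = P.1 := by
    ext M
    exact ⟨fun h => OrbitAtom.GroupAction.prop_of_ass_subset_assOf hNoeth hI hTorf hStar P.2 h.1 h.2,
      fun h => ⟨P.2.1.le_noetherian _ h, Set.subset_iUnion₂_of_subset M h subset_rfl⟩⟩
  have hassOf := ρ.assOf_assInv hNoeth
  have hmono {P Q : ObjectProperty C} (h : P ≤ Q) : ρ.assOf P ⊆ ρ.assOf Q :=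
    Set.iUnion₂_subset fun X hX => Set.subset_iUnion₂_of_subset X (h X hX) subset_rfl
  refine ⟨{ toFun := fun P => ρ.assOf P.1
            invFun := fun Φ => ⟨ρ.assInv Φ, ρ.assInv_mem_torfG Φ⟩
            left_inv := fun P => Subtype.ext (hinv P)
            right_inv := hassOf
            map_rel_iff' := fun {P Q} => ⟨fun h => ?_, fun h => hmono h⟩ },
    fun _ => rfl, fun _ => rfl⟩
  rw [← Subtype.coe_le_coe, ← hinv P, ← hinv Q]
  exact fun M hM => ⟨hM.1, hM.2.trans h⟩
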